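/- Model. Let $G_\Delta$ be the infinite regular triangular grid graph, and let $S$ be a finite, non-empty, connected set of $n$ of its nodes, each occupied by one (contracted, non-moving) amoebot. Amoebots are anonymous copies of one randomized finite state machine, which does not depend on $S$ or $n$; they share a common compass orientation and chirality, know which of their six adjacent nodes are occupied, and act in synchronous rounds. Every two neighboring amoebots are joined by $k$ external links, commonly labelled by both, whose ends are pins of the respective amoebots. In each round every amoebot, depending on its state, the beeps it received in the previous round and a fair coin toss (all tosses independent), updates its state, chooses a partition of its pins into partition sets, and beeps on any selection of these. The circuits are the connected components of the graph whose vertices are all partition sets of all amoebots and whose edges are given by the external links; a beep is received, for use in the next round, at all partition sets of the circuit on which it is sent, without information on the number or origin of the senders. Problem. Let $d$ be one of the twelve cardinal directions (the six directions along the axes of $G_\Delta$ and the six directions perpendicular to the axes), and let $\emptyset\neq R\subseteq S$. For $w\in R$ let $f_d(R,w)$ be the number of $v\in R$ that lie in direction $d$ from $w$, i.e. $\langle v-w,d\rangle>0$. The set of global maxima of $R$ with respect to $d$ is $\operatorname{argmin}_{w\in R} f_d(R,w)$. Initially each amoebot knows only $d$ and whether it belongs to $R$; each amoebot has to output, irrevocably,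 whether it is a global maximum. Theorem. With $k=2$ external links between neighbors, there is an algorithm that solves the global maxima problem in $O(\log^2 n)$ rounds w.h.p.: there is a single algorithm such that for every $c\in\mathbb N$ there is a constant $C$ such that for all $S$, $R$, $d$ as above and every integer $T\ge C\log^2 n$, with probability at least $1-n^{-c}$, after $T$ rounds every amoebot of $S$ has output correctly whether it belongs to $\operatorname{argmin}_{w\in R} f_d(R,w)$. -/

import Mathlib

open MeasureTheory

namespace Amoebot

/-! ## The triangular grid -/

/-- A node of the infinite regular triangular grid. The pair `(x, y)` stands for the point
`x * ENE + y * N` of the plane, where `N = (0, 1)` and `ENE = (√3 / 2, 1 / 2)`. -/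
abbrev Node : Type := ℤ × ℤ

/-- The six cardinal directions along the axes of the grid. -/
inductive AxisDir : Type
  | N | ENE | ESE | S | WSW | WNW
  deriving DecidableEq

instance : Fintype AxisDir where
  elems := {.N, .ENE, .ESE, .S, .WSW, .WNW}
  complete e := by cases e <;> simp

/-- The six cardinal directions perpendicular to the axes of the grid. -/
inductive PerpDir : Type
  | E | SSE | SSW | W | NNW | NNE
  deriving DecidableEq

instance : Fintype PerpDir where
  elems := {.E, .SSE, .SSW, .W, .NNW, .NNE}
  complete e := by cases e <;> simp

/-- All twelve cardinal directions. -/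
abbrev Direction : Type := AxisDir ⊕ PerpDir

/-- The unit vector of an axis direction, in the coordinates of `Node`. -/
def AxisDir.vec : AxisDir → Node
  | .N => (0, 1)
  | .ENE => (1, 0)
  | .ESE => (1, -1)
  | .S => (0, -1)
  | .WSW => (-1, 0)
  | .WNW => (-1, 1)

/-- The opposite axis direction. -/
def AxisDir.opp : AxisDir → AxisDir
  | .N => .S
  | .ENE => .WSW
  | .ESE => .WNW
  | .S => .N
  | .WSW => .ENE
  | .WNW => .ESE

theorem AxisDir.vec_opp (e : AxisDir) : e.opp.vec = -e.vec := by
  cases e <;> rfl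

/-- A vector that points in the given perpendicular direction, namely the sum of the two
neighbouring axis directions (`E = ENE + ESE`, and so on). -/
def PerpDir.vec : PerpDir → Node
  | .E => (2, -1)
  | .SSE => (1, -2)
  | .SSW => (-1, -1)
  | .W => (-2, 1)
  | .NNW => (-1, 2)
  | .NNE => (1, 1)

/-- A vector that points in the given cardinal direction. -/
def Direction.vec : Direction → Node
  | .inl e => e.vec
  | .inr e => e.vec

/-- Twice the Euclidean inner product of two vectors given in the coordinates of `Node`. -/
def dot (a b : Node) : ℤ :=
  2 * a.1 * b.1 + 2 * a.2 * b.2 + a.1 * b.2 + a.2 * b.1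

/-- The infinite regular triangular grid graph. -/
def triGrid : SimpleGraph Node where
  Adj u v := ∃ e : AxisDir, v = u + e.vec
  symm := ⟨by
    rintro u v ⟨e, rfl⟩
    exact ⟨e.opp, by rw [AxisDir.vec_opp, add_neg_cancel_right]⟩⟩
  loopless := ⟨by
    rintro u ⟨e, he⟩
    have h : e.vec = 0 := by simpa using he
    cases e <;> simp [AxisDir.vec] at h⟩

/-! ## The global maxima problem -/

/-- The number of amoebots of `R` that lie in direction `d` from `w`, i.e. strictly ahead of the
line through `w` that is perpendicular to `d`. -/
def numAhead (d : Direction) (R : Finset Node) (w : Node) : ℕ :=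
  (R.filter fun v => 0 < dot (v - w) d.vec).card

/-- The global maxima of `R` with respect to `d`: the set `argmin_{w ∈ R} numAhead d R w`. -/
def globalMaxima (d : Direction) (R : Finset Node) : Finset Node :=
  R.filter fun w => ∀ w' ∈ R, numAhead d R w ≤ numAhead d R w'

/-! ## The amoebot model with reconfigurable circuits -/

/-- The possible pins of an amoebot, when there are `k` external links between neighbours:
`(e, i)` is its end of the `i`-th link to the neighbour in direction `e`.
The pin is really there only if the adjacent node in direction `e` is occupied. -/
abbrev Pin (k : ℕ) : Type := AxisDir × Fin k

/-- What an amoebot does when it is activated (amoebots do not move): it updates its state, it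
chooses a pin configuration, whose partition sets are the classes of the equivalence relation
`pins` (restricted to the pins that are really there), and it beeps on
the partition sets of the pins `p` with `beep p = true`. -/
structure Action (k : ℕ) (State : Type) where
  state : State
  pins : Setoid (Pin k)
  beep : Pin k → Bool

/-- An algorithm: the randomized finite state machine that every amoebot runs. There are no
identities, and the machine does not depend on the structure or on its size. All amoebots share
their compass orientation and chirality. -/
structure Algorithm (k : ℕ) where
  /-- The states of an amoebot. -/
  State : Type
  finite_state : Finite State
  /-- The initial state of an amoebot, given the direction `d` and whether the amoebot is in `R`. -/
  init : Direction → Bool → State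
  /-- The activation of an amoebot, as a function of its state, of which of the adjacent nodes are
  occupied, of the pins at which it has received a beep, and of the toss of a fair coin. -/
  step : State → (AxisDir → Bool) → (Pin k → Bool) → Bool → Action k State
  /-- The answer of an amoebot, `none` while it is undecided. -/
  output : State → Option Bool
  /-- Answers are final. -/
  output_step : ∀ (s : State) (occ : AxisDir → Bool) (heard : Pin k → Bool) (coin b : Bool),
    output s = some b → output (step s occ heard coin).state = some b

/-- Whether the node adjacent to `u` in direction `e` is occupied. -/
def occupied (S : Finset Node) (u : Node) (e : AxisDir) : Bool :=
  decide (u + e.vec ∈ S)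

/-- The direct connections between pins: two pins of an amoebot in the same partition set, and
the two ends of an external link (neighbours label their common links in the same way). -/
inductive Wire {k : ℕ} (S : Finset Node) (pins : S → Setoid (Pin k)) :
    S × Pin k → S × Pin k → Prop
  | inner (u : S) (p q : Pin k) (hp : occupied S u p.1 = true) (hq : occupied S u q.1 = true)
      (h : (pins u).r p q) : Wire S pins (u, p) (u, q)
  | link (u v : S) (e : AxisDir) (i : Fin k) (h : (v : Node) = u + e.vec) :
      Wire S pins (u, (e, i)) (v, (e.opp, i))

/-- Two pins lie on the same circuit, i.e. their partition sets are in the same connected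
component of the pin configuration of the system. -/
def SameCircuit {k : ℕ} (S : Finset Node) (pins : S → Setoid (Pin k)) :
    S × Pin k → S × Pin k → Prop :=
  Relation.EqvGen (Wire S pins)

/-- A pin `p` of `u` receives a beep iff some amoebot beeps on the circuit of `p`. -/
def Hears {k : ℕ} (S : Finset Node) (pins : S → Setoid (Pin k)) (beep : S → Pin k → Bool)
    (u : S) (p : Pin k) : Prop :=
  occupied S u p.1 = true ∧
    ∃ (v : S) (q : Pin k), occupied S v q.1 = true ∧ beep v q = true ∧
      SameCircuit S pins (u, p) (v, q)

/-- A configuration between two rounds: the states of the amoebots, and the pins at which they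
have received a beep in the last round. -/
structure Config {k : ℕ} (A : Algorithm k) (S : Finset Node) where
  state : S → A.State
  heard : S → Pin k → Bool

/-- One synchronous round, with `coins u` the coin toss of amoebot `u`. -/
noncomputable def Algorithm.round {k : ℕ} (A : Algorithm k) (S : Finset Node) (coins : S → Bool)
    (γ : Config A S) : Config A S :=
  let act : S → Action k A.State := fun u =>
    A.step (γ.state u) (occupied S u) (γ.heard u) (coins u)
  { state := fun u => (act u).state
    heard := fun u p =>
      open Classical in
      decide (Hears S (fun v => (act v).pins) (fun v => (act v).beep) u p) }

/-- The configuration after `t` rounds on the structure `S` with input `d` and `R`, where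
`ω (t, u)` is the coin toss of amoebot `u` in round `t`. -/
noncomputable def Algorithm.run {k : ℕ} (A : Algorithm k) (S R : Finset Node) (d : Direction)
    (ω : ℕ × S → Bool) : ℕ → Config A S
  | 0 => { state := fun u => A.init d (decide ((u : Node) ∈ R)), heard := fun _ _ => false }
  | t + 1 => A.round S (fun u => ω (t, u)) (A.run S R d ω t)

/-- After `t` rounds every amoebot has determined whether it is a global maximum of `R` with
respect to `d`. -/
def Algorithm.SolvedAt {k : ℕ} (A : Algorithm k) (S R : Finset Node) (d : Direction)
    (ω : ℕ × S → Bool) (t : ℕ) : Prop :=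
  ∀ u : S, A.output ((A.run S R d ω t).state u) =
    some (decide ((u : Node) ∈ globalMaxima d R))

/-- The law of the coin tosses: all tosses are fair and independent. -/
noncomputable def coinLaw (S : Finset Node) : Measure (ℕ × S → Bool) :=
  Measure.infinitePi fun _ => (PMF.uniformOfFintype Bool).toMeasure

end Amoebot

namespace Amoebot

/-! ## Heights -/

/-! The global maxima are the highest nodes of `R`, so relative heights are computed bit by bit over
circuits. Links are crossed exactly where the current binary digit of the height changes. The
structure then carries two circuits, one for each digit value. When the references, a subset of the
candidates, beep on their own circuit, every amoebot learns whether its digit differs from theirs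
(`sameCircuit_iff`, `reference_round`). If the references disagree, everyone hears both circuits.
The digit is then repeated, while coin tosses thin out the references (`elimination`). A neighbour's
height difference stays in `[-3, 3]` when digits are shifted out, so finitely many states suffice.

Passes alternate between two kinds. In the first, the last digit is the sign of the height relative
to the references, and candidates below them drop out (`PassInv.sign_step`). In the second, all
candidates are at least as high as the references, and only those having the most significant digit
in use survive, as the new references. This halves the bound `2 ^ B` on the spread of the candidates
(`PassInv.mark_step`). If no digit is in use, all candidates are equally high, and they are the
maxima (`PassInv.cand_iff_mem_globalMaxima`).

A pass processes at most `L` digits, where `2 ^ L` exceeds all height differences. Conflicts require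
two references that have tossed equal coins so far, which is excluded after `k` cycles if the coins
distinguish all amoebots (`PassInv.exists_end`). Hence `2 * (L + 1)` passes of at most `k + L + 1`
cycles suffice. With `k` and `L` logarithmic this gives `O(log² n)` rounds, and a union bound over
pairs and starting times controls the failure probability. -/

/-- The height of a node in direction `d`. -/
def height (d : Direction) (v : Node) : ℤ := dot v d.vec

theorem height_add (d : Direction) (u v : Node) :
    height d (u + v) = height d u + height d v := by
  simp only [height, dot, Prod.fst_add, Prod.snd_add]; ring

theorem dot_sub_vec (d : Direction) (v w : Node) :
    dot (v - w) d.vec = height d v - height d w := by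
  simp only [height, dot, Prod.fst_sub, Prod.snd_sub]; ring

/-- The height difference along an edge. -/
def slope (d : Direction) (e : AxisDir) : Set.Icc (-3 : ℤ) 3 :=
  ⟨height d e.vec, by
    rcases d with d | d <;> cases d <;> cases e <;>
      simp [height, dot, Direction.vec, AxisDir.vec, PerpDir.vec]⟩

/-- The global maxima are the highest nodes of `R`. -/
theorem mem_globalMaxima_iff (d : Direction) (R : Finset Node) (w : Node) :
    w ∈ globalMaxima d R ↔ w ∈ R ∧ ∀ v ∈ R, height d v ≤ height d w := by
  have zero : ∀ u, numAhead d R u = 0 ↔ ∀ v ∈ R, height d v ≤ height d u := by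
    intro u
    simp [numAhead, Finset.filter_eq_empty_iff, dot_sub_vec]
  simp only [globalMaxima, Finset.mem_filter, and_congr_right_iff]
  intro hw
  constructor
  · intro h
    -- A highest node has nobody ahead, so the minimum of `numAhead` is zero.
    obtain ⟨m, hm, hmax⟩ := R.exists_max_image (height d) ⟨w, hw⟩
    have := h m hm
    rw [(zero m).2 hmax] at this
    exact (zero w).1 (by omega)
  · intro h w' _
    rw [(zero w).2 h]
    exact Nat.zero_le _

/-! ## Two circuits -/

/-- The directions at whose pins an amoebot may cross the two links. -/
def AxisDir.up : AxisDir → Bool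
  | .N | .ENE | .ESE => true
  | .S | .WSW | .WNW => false

theorem AxisDir.up_opp (e : AxisDir) : e.opp.up = !e.up := by
  cases e <;> rfl

/-- The partition set of a pin when an amoebot uses two partition sets and crosses the links
in the directions `e` with `cross e = true`. -/
def pinLabel (cross : AxisDir → Bool) (p : Pin 2) : Bool :=
  xor (p.2 == 1) (p.1.up && cross p.1)

theorem exists_pinLabel (cross : AxisDir → Bool) (e : AxisDir) (b : Bool) :
    ∃ i, pinLabel cross (e, i) = b := by
  refine ⟨if xor b (e.up && cross e) then 1 else 0, ?_⟩
  unfold pinLabel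
  cases b <;> cases e.up && cross e <;> rfl

variable {S : Finset Node}

theorem connected_induction (hS : (triGrid.induce (S : Set Node)).Connected) (P : S → Prop) (u : S)
    (hu : P u) (h : ∀ (v w : S) (e : AxisDir), (w : Node) = v + e.vec → P v → P w) (w : S) :
    P w := by
  obtain ⟨walk⟩ := hS.preconnected u w
  induction walk with
  | nil => exact hu
  | cons hadj _ ih =>
    obtain ⟨e, he⟩ := hadj
    exact ih (h _ _ e he hu)

/-- A single amoebot has no pins and cannot hear even its own beep. This is why `2 ≤ S.card` is
required wherever beeps matter. -/
theorem exists_occupied (hS : (triGrid.induce (S : Set Node)).Connected) (hn : 2 ≤ S.card)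
    (u : S) : ∃ e, occupied S u e = true := by
  by_contra hno
  push Not at hno
  have hall : ∀ w : S, w = u := by
    refine connected_induction hS _ u rfl ?_
    rintro v w e he rfl
    exact absurd (by simp [occupied, ← he]) (hno e)
  have : S.card ≤ 1 := Finset.card_le_one.2 fun a ha b hb => by
    have h1 := hall ⟨a, ha⟩
    have h2 := hall ⟨b, hb⟩
    exact congrArg Subtype.val (h1.trans h2.symm)
  omega

/-- `β` is a two-colouring that changes exactly along the crossed edges. -/
def Compatible (cross : S → AxisDir → Bool) (β : S → Bool) : Prop :=
  ∀ (u v : S) (e : AxisDir), (v : Node) = u + e.vec → e.up = true → β v = xor (β u) (cross u e)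

/-- Only the end at which the edge points up applies the crossing, so each edge is crossed at most
once. The change of label along the link then cancels the change of `β`. -/
theorem pinLabel_link {cross : S → AxisDir → Bool} {β : S → Bool} (hβ : Compatible cross β)
    (u v : S) (e : AxisDir) (i : Fin 2) (h : (v : Node) = u + e.vec) :
    xor (pinLabel (cross u) (e, i)) (β u) = xor (pinLabel (cross v) (e.opp, i)) (β v) := by
  cases hup : e.up
  · have h' : (u : Node) = v + e.opp.vec := by rw [AxisDir.vec_opp, h]; abel
    rw [hβ v u e.opp h' (by rw [AxisDir.up_opp, hup]; rfl)]
    simp only [pinLabel, AxisDir.up_opp, hup]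
    cases (i == 1) <;> cases β v <;> cases cross v e.opp <;> rfl
  · rw [hβ u v e h hup]
    simp only [pinLabel, AxisDir.up_opp, hup]
    cases (i == 1) <;> cases β u <;> cases cross u e <;> rfl

/-- The label corrected by `β` is invariant along wires, so there are at least two classes. Since
both links of every edge are wired, connectivity spreads each class over the whole structure. -/
theorem sameCircuit_iff (hS : (triGrid.induce (S : Set Node)).Connected)
    {cross : S → AxisDir → Bool} {β : S → Bool} (hβ : Compatible cross β) (u v : S) (p q : Pin 2)
    (hp : occupied S u p.1 = true) (hq : occupied S v q.1 = true) :
    SameCircuit S (fun u => Setoid.ker (pinLabel (cross u))) (u, p) (v, q) ↔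
      xor (pinLabel (cross u) p) (β u) = xor (pinLabel (cross v) q) (β v) := by
  constructor
  · intro h
    have key : ∀ a b, SameCircuit S (fun u => Setoid.ker (pinLabel (cross u))) a b →
        xor (pinLabel (cross a.1) a.2) (β a.1) = xor (pinLabel (cross b.1) b.2) (β b.1) := by
      intro a b hab
      induction hab with
      | rel a b hab =>
        cases hab with
        | inner u p q _ _ h => exact congrArg (xor · (β u)) h
        | link u v e i h => exact pinLabel_link hβ u v e i h
      | refl => rfl
      | symm _ _ _ ih => exact ih.symm
      | trans _ _ _ _ _ ih₁ ih₂ => exact ih₁.trans ih₂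
    exact key _ _ h
  · refine connected_induction hS (fun v => ∀ q : Pin 2, occupied S v q.1 = true →
      xor (pinLabel (cross u) p) (β u) = xor (pinLabel (cross v) q) (β v) →
      SameCircuit S (fun u => Setoid.ker (pinLabel (cross u))) (u, p) (v, q)) u ?_ ?_ v q hq
    · intro q hq h
      exact .rel _ _ (.inner u p q hp hq (by simpa using h))
    · intro v w e he ih q hq h
      -- Of the two links from `v` to `w`, the one that belongs to the circuit of `p` is used.
      obtain ⟨i, hi⟩ := exists_pinLabel (cross v) e
        (xor (β v) (xor (pinLabel (cross u) p) (β u)))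
      have hi' : xor (pinLabel (cross u) p) (β u) = xor (pinLabel (cross v) (e, i)) (β v) := by
        rw [hi]; cases β v <;> simp
      have ho : occupied S v e = true := by simp [occupied, ← he]
      have ho' : occupied S w e.opp = true := by
        simp [occupied, he, AxisDir.vec_opp]
      refine .trans _ _ _ (ih (e, i) ho hi') (.trans _ _ _ (.rel _ _ (.link v w e i he)) (.rel _ _
        (.inner w (e.opp, i) q ho' hq ?_)))
      have h3 := (pinLabel_link hβ v w e i he).symm.trans (hi'.symm.trans h)
      simpa using h3

/-- Whether an amoebot has received a beep at its partition set `b`. -/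
def heardOn (cross : AxisDir → Bool) (occ : AxisDir → Bool) (heard : Pin 2 → Bool) (b : Bool) :
    Bool :=
  decide (∃ p : Pin 2, occ p.1 = true ∧ heard p = true ∧ pinLabel cross p = b)

open Classical in
theorem heardOn_hears (hS : (triGrid.induce (S : Set Node)).Connected) (hn : 2 ≤ S.card)
    {cross : S → AxisDir → Bool} {β : S → Bool} (hβ : Compatible cross β)
    (signal : S → Bool → Bool) (u : S) (b : Bool) :
    heardOn (cross u) (occupied S u) (fun p => decide
      (Hears S (fun v => Setoid.ker (pinLabel (cross v)))
        (fun v p => signal v (pinLabel (cross v) p)) u p)) b = true ↔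
      ∃ v, signal v (xor b (xor (β u) (β v))) = true := by
  rw [heardOn, decide_eq_true_iff]
  constructor
  · rintro ⟨p, hp, hh, rfl⟩
    obtain ⟨-, v, q, hq, hb, hc⟩ := of_decide_eq_true hh
    refine ⟨v, ?_⟩
    rw [sameCircuit_iff hS hβ u v p q hp hq] at hc
    rw [← Bool.xor_assoc, hc]
    simpa using hb
  · rintro ⟨v, hv⟩
    obtain ⟨e, he⟩ := exists_occupied hS hn u
    obtain ⟨e', he'⟩ := exists_occupied hS hn v
    obtain ⟨i, hi⟩ := exists_pinLabel (cross u) e b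
    obtain ⟨i', hi'⟩ := exists_pinLabel (cross v) e' (xor b (xor (β u) (β v)))
    refine ⟨(e, i), he, decide_eq_true ⟨he, v, (e', i'), he', (congrArg (signal v) hi').trans hv, ?_⟩, hi⟩
    rw [sameCircuit_iff hS hβ u v _ _ he he', hi, hi']
    cases b <;> cases β u <;> cases β v <;> rfl

/-! ## The algorithm -/

/-- The three kinds of rounds of a cycle: the references beep, the candidates for the reference
beep according to their coins, and the amoebots report on the current bit. -/
inductive Phase : Type
  | reference | coin | report
  deriving DecidableEq

instance : Finite Phase :=
  Finite.of_injective (fun p : Phase => ((decide (p = .reference), decide (p = .coin)) : Bool × Bool))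
    (by intro a b; cases a <;> cases b <;> simp)

/-- The state of an amoebot. All heights are relative to the height of the references, and their
binary digits are computed one after the other, beginning with the least significant one. -/
structure MState : Type where
  /-- the direction -/
  dir : Direction
  /-- the kind of the last round -/
  phase : Phase
  /-- whether all candidates are known to be at least as high as the reference -/
  stage : Bool
  /-- whether some candidate has had a nonzero digit in this pass -/
  any : Bool
  /-- whether the references disagree on the current digit -/
  conflict : Bool
  /-- whether the amoebot is a candidate for a global maximum -/
  cand : Bool
  /-- whether the amoebot is a reference -/
  ref : Bool
  /-- whether the last coin toss was tails -/
  tails : Bool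
  /-- the current digit of the height -/
  bit : Bool
  /-- whether the amoebot can see that more digits are needed -/
  busy : Bool
  /-- the digit at the last position where a candidate had a nonzero digit -/
  mark : Bool
  /-- the differences to the heights of the neighbours, after removing the known digits -/
  diff : AxisDir → Set.Icc (-3 : ℤ) 3
  /-- the answer -/
  ans : Option Bool

instance : Finite MState :=
  Finite.of_injective
    (fun s : MState => (s.dir, s.phase, s.stage, s.any, s.conflict, s.cand, s.ref, s.tails, s.bit,
      s.busy, s.mark, s.diff, s.ans))
    (by
      rintro ⟨⟩ ⟨⟩ h
      simp only [Prod.mk.injEq] at h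
      simpa using h)

namespace MState

/-- Where the amoebot crosses its links. -/
def cross (s : MState) (e : AxisDir) : Bool :=
  decide (s.phase = .reference) && decide ((s.diff e : ℤ) % 2 = 1)

/-- The partition sets on which the amoebot beeps. -/
def signal (s : MState) (b : Bool) : Bool :=
  match s.phase, b with
  | .reference, false => s.ref
  | .coin, false => s.ref && !s.tails
  | .report, false => s.busy
  | .report, true => s.stage && s.cand && s.bit
  | _, _ => false

/-- The differences after the removal of the digit `b`. -/
def halve (b : Bool) (c : Set.Icc (-3 : ℤ) 3) : Set.Icc (-3 : ℤ) 3 :=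
  ⟨((if b then 1 else 0) + c) / 2, by
    obtain ⟨c, h₁, h₂⟩ := c
    cases b <;> simp <;> omega⟩

/-- Whether a difference shows that the remaining digits of the two heights are not constant. -/
def unfinished (b : Bool) (c : ℤ) : Bool :=
  decide (c ≠ (if b then 1 else 0) - ((if b then 1 else 0) + c) % 2)

/-- The update after the report round, where `busy` and `ones` tell whether some amoebot is busy
and whether some candidate has a nonzero digit. -/
def afterReport (s : MState) (busy ones : Bool) : MState :=
  if s.conflict then { s with phase := .reference }
  else if busy then
    { s with
      phase := .reference
      any := s.any || ones
      mark := if ones then s.bit else s.mark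
      diff := fun e => halve s.bit (s.diff e) }
  else if !s.stage then
    { s with
      phase := .reference
      stage := true
      any := false
      cand := s.cand && !s.bit
      diff := slope s.dir }
  else if s.any then
    { s with
      phase := .reference
      stage := false
      any := false
      cand := s.cand && s.mark
      ref := s.cand && s.mark
      diff := slope s.dir }
  else { s with ans := some s.cand }

/-- The update after the coin round, where `heads` tells whether some reference tossed heads. -/
def afterCoin (s : MState) (occ : AxisDir → Bool) (heads : Bool) : MState :=
  { s with
    phase := .report
    ref := s.ref && !(s.tails && heads)
    busy := decide (∃ e, occ e = true ∧ unfinished s.bit (s.diff e) = true) }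

/-- The update after the reference round. -/
def afterReference (s : MState) (zero one coin : Bool) : MState :=
  { s with
    phase := .coin
    conflict := zero && one
    bit := one
    tails := !coin }

/-- The transition function, where `hear` tells which partition sets have received a beep. -/
def next (s : MState) (occ : AxisDir → Bool) (hear : Bool → Bool) (coin : Bool) : MState :=
  if s.ans.isSome then s
  else match s.phase with
    | .reference => s.afterReference (hear false) (hear true) coin
    | .coin => s.afterCoin occ (hear false)
    | .report => s.afterReport (hear false) (hear true)

theorem ans_next (s : MState) (occ : AxisDir → Bool) (hear : Bool → Bool) (coin b : Bool)
    (h : s.ans = some b) : (s.next occ hear coin).ans = some b := by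
  simp [next, h]

/-- The initial state. -/
def start (d : Direction) (b : Bool) : MState where
  dir := d
  -- The first activation has no beeps to interpret. Starting with a silent coin round (`tails :=
  -- true`) and a pretended conflict makes the first two rounds idle.
  phase := .coin
  stage := false
  any := false
  conflict := true
  cand := b
  ref := b
  tails := true
  bit := false
  busy := false
  mark := false
  diff := slope d
  ans := none

/-- The action of an amoebot that has reached the state `s`. -/
def act (s : MState) : Action 2 MState where
  state := s
  pins := Setoid.ker (pinLabel s.cross)
  beep p := s.signal (pinLabel s.cross p)

end MState

/-- The algorithm for the global maxima problem. -/
def maximaAlgorithm : Algorithm 2 where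
  State := MState
  finite_state := inferInstance
  init := MState.start
  step s occ heard coin := (s.next occ (heardOn s.cross occ heard) coin).act
  output := MState.ans
  output_step s _ _ _ _ h := MState.ans_next s _ _ _ _ h

/-! ### Received beeps in terms of the states -/

variable {R : Finset Node} {d : Direction}

/-- The states after `t` rounds. -/
noncomputable def states (S R : Finset Node) (d : Direction) (ω : ℕ × S → Bool) (t : ℕ) (u : S) :
    MState :=
  (maximaAlgorithm.run S R d ω t).state u

/-- The partition sets on which an amoebot receives a beep, in terms of the states. -/
def Received (s : S → MState) (u : S) (hear : Bool → Bool) : Prop :=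
  ∀ β : S → Bool, Compatible (fun u => (s u).cross) β → ∀ b,
    hear b = true ↔ ∃ v, (s v).signal (xor b (xor (β u) (β v))) = true

theorem states_succ (hS : (triGrid.induce (S : Set Node)).Connected) (hn : 2 ≤ S.card)
    (ω : ℕ × S → Bool) (t : ℕ) (u : S) :
    ∃ hear, Received (states S R d ω t) u hear ∧
      states S R d ω (t + 1) u = (states S R d ω t u).next (occupied S u) hear (ω (t, u)) := by
  refine ⟨_, ?_, rfl⟩
  intro β hβ b
  cases t with
  | zero =>
    have h1 : ∀ v b, (states S R d ω 0 v).signal b = false := by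
      intro v b
      cases b <;> simp [states, Algorithm.run, maximaAlgorithm, MState.start, MState.signal]
    simp only [h1]
    simp [Algorithm.run, heardOn]
  | succ t => exact heardOn_hears hS hn hβ (fun v => (states S R d ω (t + 1) v).signal) u b


/-! ## One cycle -/

/-- Outside the reference round nothing is crossed, so the constant colouring is compatible and both
circuits act as global broadcast channels. -/
theorem received_iff {s : S → MState} {u : S} {hear : Bool → Bool} (h : Received s u hear)
    (hs : ∀ u, (s u).phase ≠ .reference) (b : Bool) :
    hear b = true ↔ ∃ v, (s v).signal b = true := by
  have := h (fun _ => false) (by intro u v e _ _; simp [MState.cross, hs]) b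
  simpa using this

section Rounds

variable (hS : (triGrid.induce (S : Set Node)).Connected) (hn : 2 ≤ S.card) (ω : ℕ × S → Bool)
  {t : ℕ}

include hS hn

theorem coin_round (hp : ∀ u, (states S R d ω t u).phase = .coin)
    (ha : ∀ u, (states S R d ω t u).ans = none) :
    ∃ heads : Bool,
      (heads = true ↔ ∃ v, (states S R d ω t v).ref = true ∧ (states S R d ω t v).tails = false) ∧
      ∀ u, states S R d ω (t + 1) u = (states S R d ω t u).afterCoin (occupied S u) heads := by
  classical
  refine ⟨decide _, decide_eq_true_iff, fun u => ?_⟩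
  obtain ⟨hear, hh, hu⟩ := states_succ (R := R) (d := d) hS hn ω t u
  have h := received_iff hh (by simp [hp]) false
  rw [hu, MState.next, ha, hp]
  simp only [Option.isSome_none, Bool.false_eq_true, if_false]
  congr 1
  rw [Bool.eq_iff_iff, h, decide_eq_true_iff]
  simp [MState.signal, hp]

theorem report_round (hp : ∀ u, (states S R d ω t u).phase = .report)
    (ha : ∀ u, (states S R d ω t u).ans = none) :
    ∃ busy ones : Bool,
      (busy = true ↔ ∃ v, (states S R d ω t v).busy = true) ∧
      (ones = true ↔ ∃ v, (states S R d ω t v).stage = true ∧ (states S R d ω t v).cand = true ∧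
        (states S R d ω t v).bit = true) ∧
      ∀ u, states S R d ω (t + 1) u = (states S R d ω t u).afterReport busy ones := by
  classical
  refine ⟨decide _, decide _, decide_eq_true_iff, decide_eq_true_iff, fun u => ?_⟩
  obtain ⟨hear, hh, hu⟩ := states_succ (R := R) (d := d) hS hn ω t u
  have h := received_iff hh (by simp [hp])
  rw [hu, MState.next, ha, hp]
  simp only [Option.isSome_none, Bool.false_eq_true, if_false]
  congr 1
  · rw [Bool.eq_iff_iff, h, decide_eq_true_iff]
    simp [MState.signal, hp]
  · rw [Bool.eq_iff_iff, h, decide_eq_true_iff]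
    simp [MState.signal, hp, and_assoc]

end Rounds

/-- The `i`-th binary digit of the height of `u` relative to `m`. -/
def digit (d : Direction) (i : ℕ) (m u : Node) : Bool :=
  decide ((height d u - height d m) / 2 ^ i % 2 = 1)

/-- The states at the beginning of a cycle, when the first `i` digits have been processed. -/
structure Rep (d : Direction) (s : S → MState) (i : ℕ) (stage any : Bool) : Prop where
  dir : ∀ u, (s u).dir = d
  phase : ∀ u, (s u).phase = .reference
  stage_eq : ∀ u, (s u).stage = stage
  any_eq : ∀ u, (s u).any = any
  ans : ∀ u, (s u).ans = none
  exists_ref : ∃ m, (s m).ref = true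
  agree : ∀ m m' : S, (s m).ref = true → (s m').ref = true →
    (2 ^ i : ℤ) ∣ height d m - height d m'
  diff : ∀ m : S, (s m).ref = true → ∀ (u : S) (e : AxisDir), ((s u).diff e : ℤ) =
    (height d (u + e.vec) - height d m) / 2 ^ i - (height d u - height d m) / 2 ^ i

/-- Neighbours differ in the current digit exactly when the difference of their shifted heights is
odd, which is where links are crossed. -/
theorem Rep.compatible {s : S → MState} {i : ℕ} {stage any : Bool} (h : Rep d s i stage any)
    {m : S} (hm : (s m).ref = true) :
    Compatible (fun u => (s u).cross) (fun u => digit d i m u) := by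
  intro u v e hv _
  simp only [MState.cross, h.phase, h.diff m hm u e, digit, hv, decide_true, Bool.true_and]
  generalize (height d (↑u + e.vec) - height d m) / 2 ^ i = a
  generalize (height d u - height d m) / 2 ^ i = b
  rcases Int.emod_two_eq_zero_or_one a with ha | ha <;>
    rcases Int.emod_two_eq_zero_or_one b with hb | hb <;>
    simp [ha, hb] <;> omega

theorem digit_self (i : ℕ) (m : Node) : digit d i m m = false := by
  simp [digit]

/-- An amoebot hears on `b` iff its digit differs by `b` from that of some reference. Disagreeing
references thus reach both partition sets of everyone, so the conflict is common knowledge.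
Otherwise the beep on `true` is the digit. -/
theorem reference_round (hS : (triGrid.induce (S : Set Node)).Connected) (hn : 2 ≤ S.card)
    (ω : ℕ × S → Bool) {t i : ℕ} {stage any : Bool}
    (h : Rep d (states S R d ω t) i stage any) :
    ∃ conflict : Bool,
      (conflict = true ↔ ∃ m m', (states S R d ω t m).ref = true ∧
        (states S R d ω t m').ref = true ∧ digit d i m m' = true) ∧
      ∀ u, ∃ zero one, states S R d ω (t + 1) u =
          (states S R d ω t u).afterReference zero one (ω (t, u)) ∧
        (zero && one) = conflict ∧
        (conflict = false → ∀ m, (states S R d ω t m).ref = true → one = digit d i m u) := by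
  classical
  refine ⟨decide _, decide_eq_true_iff, fun u => ?_⟩
  obtain ⟨hear, hh, hu⟩ := states_succ (R := R) (d := d) hS hn ω t u
  have key : ∀ m, (states S R d ω t m).ref = true → ∀ b, hear b = true ↔
      ∃ v, (states S R d ω t v).ref = true ∧ b = xor (digit d i m u) (digit d i m v) := by
    intro m hm b
    rw [hh _ (h.compatible hm) b]
    refine exists_congr fun v => ?_
    generalize digit d i m u = x
    generalize digit d i m v = y
    cases b <;> cases x <;> cases y <;> simp [MState.signal, h.phase]
  refine ⟨hear false, hear true, ?_, ?_, ?_⟩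
  · rw [hu, MState.next, h.ans, h.phase]
    simp
  · rw [Bool.eq_iff_iff, Bool.and_eq_true, decide_eq_true_iff]
    constructor
    · rintro ⟨h0, h1⟩
      obtain ⟨m, hm⟩ := h.exists_ref
      rw [key m hm] at h0 h1
      obtain ⟨v, hv, h0⟩ := h0
      obtain ⟨w, hw, h1⟩ := h1
      cases hx : digit d i m v
      · refine ⟨m, w, hm, hw, ?_⟩
        rw [hx] at h0
        revert h0 h1
        generalize digit d i m u = y
        generalize digit d i m w = z
        cases y <;> cases z <;> simp
      · exact ⟨m, v, hm, hv, hx⟩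
    · rintro ⟨m, m', hm, hm', hd⟩
      rw [key m hm, key m hm]
      cases hx : digit d i m u
      · exact ⟨⟨m, hm, by simp [digit_self]⟩, ⟨m', hm', by simp [hd]⟩⟩
      · exact ⟨⟨m', hm', by simp [hd]⟩, ⟨m, hm, by simp [digit_self]⟩⟩
  · intro hno m hm
    rw [decide_eq_false_iff_not] at hno
    push Not at hno
    have : hear true = true ↔ digit d i m u = true := by
      rw [key m hm]
      constructor
      · rintro ⟨v, hv, hb⟩
        have := hno m v hm hv
        rw [ne_eq, Bool.not_eq_true] at this
        simpa [this] using hb.symm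
      · intro hx
        exact ⟨m, hm, by simp [hx, digit_self]⟩
    exact Bool.eq_iff_iff.2 this

/-- Three rounds condensed into one update. The coin that matters is the one tossed at time `t`, and
references are thinned out whether or not there is a conflict. -/
theorem cycle (hS : (triGrid.induce (S : Set Node)).Connected) (hn : 2 ≤ S.card)
    (ω : ℕ × S → Bool) {t i : ℕ} {stage any : Bool}
    (h : Rep d (states S R d ω t) i stage any) :
    ∃ conflict heads busy ones : Bool, ∃ bit : S → Bool,
      (conflict = true ↔ ∃ m m', (states S R d ω t m).ref = true ∧
        (states S R d ω t m').ref = true ∧ digit d i m m' = true) ∧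
      (heads = true ↔ ∃ v, (states S R d ω t v).ref = true ∧ ω (t, v) = true) ∧
      (busy = true ↔ ∃ (u : S) (e : AxisDir), occupied S u e = true ∧
        MState.unfinished (bit u) ((states S R d ω t u).diff e) = true) ∧
      (ones = true ↔ stage = true ∧ ∃ v, (states S R d ω t v).cand = true ∧ bit v = true) ∧
      (conflict = false → ∀ m, (states S R d ω t m).ref = true → ∀ u : S, bit u = digit d i m u) ∧
      ∀ u, ∃ z, states S R d ω (t + 3) u = MState.afterReport
        { states S R d ω t u with
          phase := .report
          conflict := conflict
          bit := bit u
          tails := !ω (t, u)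
          ref := (states S R d ω t u).ref && !(!ω (t, u) && heads)
          busy := z } busy ones := by
  obtain ⟨conflict, hc, hr⟩ := reference_round hS hn ω h
  choose zero one h1 hK hbit using hr
  obtain ⟨heads, hh, h2⟩ := coin_round (t := t + 1) (R := R) (d := d) hS hn ω
    (by intro u; rw [h1]; rfl) (by intro u; rw [h1]; exact h.ans u)
  obtain ⟨busy, ones, hb, ho, h3⟩ := report_round (t := t + 1 + 1) (R := R) (d := d) hS hn ω
    (by intro u; rw [h2]; rfl) (by intro u; rw [h2, h1]; exact h.ans u)
  refine ⟨conflict, heads, busy, ones, one, hc, ?_, ?_, ?_, fun hcf m hm u => hbit u hcf m hm, ?_⟩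
  · rw [hh]
    simp [h1, MState.afterReference]
  · rw [hb]
    simp [h1, h2, MState.afterReference, MState.afterCoin]
  · rw [ho]
    simp [h1, h2, MState.afterReference, MState.afterCoin, h.stage_eq]
  · intro u
    refine ⟨(states S R d ω (t + 1 + 1) u).busy, ?_⟩
    rw [show t + 3 = t + 1 + 1 + 1 from rfl, h3, h2, h1, ← hK u]
    rfl

/-! ## Passes -/

/-- The invariant of the algorithm: all maxima of `R` are candidates, the heights of the candidates
differ by less than `2 ^ B`. -/
structure PassInv (R : Finset Node) (d : Direction) (s : S → MState) (B i : ℕ)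
    (stage any : Bool) : Prop extends Rep d s i stage any where
  cand_mem : ∀ u : S, (s u).cand = true → (u : Node) ∈ R
  top : ∀ u : S, (u : Node) ∈ R → (∀ w ∈ R, height d w ≤ height d u) → (s u).cand = true
  spread : ∀ q q' : S, (s q).cand = true → (s q').cand = true → height d q - height d q' < 2 ^ B
  ref_cand : ∀ m : S, (s m).ref = true → (s m).cand = true
  ref_le : stage = true → ∀ m q : S, (s m).ref = true → (s q).cand = true →
    height d m ≤ height d q
  ref_eq : stage = true → ∀ m m' : S, (s m).ref = true → (s m').ref = true →
    height d m = height d m'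
  not_any : stage = true → any = false → ∀ m q : S, (s m).ref = true → (s q).cand = true →
    (height d q - height d m) % 2 ^ i = 0
  -- `b` is the highest processed position at which some candidate has a nonzero digit.
  mark : stage = true → any = true → ∃ b : ℕ, (∃ q, (s q).cand = true ∧ (s q).mark = true) ∧
    ∀ m q : S, (s m).ref = true → (s q).cand = true →
      ((s q).mark = true → 2 ^ b ≤ (height d q - height d m) % 2 ^ i ∧
        (height d q - height d m) % 2 ^ i < 2 ^ (b + 1)) ∧
      ((s q).mark = false → (height d q - height d m) % 2 ^ i < 2 ^ b)

theorem emod_two_pow_succ (x : ℤ) (i : ℕ) :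
    x % 2 ^ (i + 1) = x % 2 ^ i + 2 ^ i * (x / 2 ^ i % 2) := by
  have hP : (0 : ℤ) < 2 ^ i := by positivity
  have h1 := Int.emod_add_mul_ediv x (2 ^ i)
  have h2 := Int.emod_add_mul_ediv x (2 ^ (i + 1))
  have h3 := Int.emod_add_mul_ediv (x / 2 ^ i) 2
  have h4 : x / 2 ^ (i + 1) = x / 2 ^ i / 2 := by
    rw [pow_succ, Int.ediv_ediv_of_nonneg (by positivity)]
  rw [h4, pow_succ] at h2
  rw [pow_succ]
  linear_combination h2 - h1 - 2 ^ i * h3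

theorem ediv_two_pow_succ (x : ℤ) (i : ℕ) : x / 2 ^ (i + 1) = x / 2 ^ i / 2 := by
  rw [pow_succ, Int.ediv_ediv_of_nonneg (by positivity)]

theorem digit_int (i : ℕ) (m u : Node) :
    (if digit d i m u then 1 else 0 : ℤ) = (height d u - height d m) / 2 ^ i % 2 := by
  unfold digit
  rcases Int.emod_two_eq_zero_or_one ((height d u - height d m) / 2 ^ i) with h | h <;> simp [h]

/-- The change from one cycle to the next cycle of the same pass. -/
structure Continue (s s' : S → MState) (coin : S → Bool) : Prop where
  ref_sub : ∀ u, (s' u).ref = true → (s u).ref = true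
  ref_coin : ∀ u v, (s' u).ref = true → (s' v).ref = true → coin u = coin v

/-- Tails are removed only if somebody tossed heads, so the references never die out and all
survivors share one coin value. -/
theorem elimination {s : S → MState} {coin : S → Bool} {heads : Bool}
    (hh : heads = true ↔ ∃ v, (s v).ref = true ∧ coin v = true) (hex : ∃ m, (s m).ref = true) :
    (∃ m, ((s m).ref && !(!coin m && heads)) = true) ∧
    ∀ u v, ((s u).ref && !(!coin u && heads)) = true → ((s v).ref && !(!coin v && heads)) = true →
      coin u = coin v := by
  constructor
  · cases heads
    · obtain ⟨m, hm⟩ := hex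
      exact ⟨m, by simp [hm]⟩
    · obtain ⟨m, hm, hc⟩ := hh.1 rfl
      exact ⟨m, by simp [hm, hc]⟩
  · intro u v hu hv
    cases heads
    · have hno : ∀ w, (s w).ref = true → coin w = false := by
        intro w hw
        by_contra hc
        exact absurd (hh.2 ⟨w, hw, by simpa using hc⟩) (by simp)
      simp only [Bool.and_false, Bool.not_false, Bool.and_true] at hu hv
      rw [hno u hu, hno v hv]
    · simp at hu hv
      rw [hu.2, hv.2]

/-- When no amoebot is busy, the remaining digits of every height are equal. -/
theorem Rep.finished (hS : (triGrid.induce (S : Set Node)).Connected) {s : S → MState} {i : ℕ}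
    {stage any : Bool} (h : Rep d s i stage any) {m : S} (hm : (s m).ref = true)
    (hb : ∀ (u : S) (e : AxisDir), occupied S u e = true →
      MState.unfinished (digit d i m u) ((s u).diff e) = false) (u : S) :
    (height d u - height d m) / 2 ^ i = 0 ∧ digit d i m u = false ∨
    (height d u - height d m) / 2 ^ i = -1 ∧ digit d i m u = true := by
  -- `x + x % 2 = 0` says that `x` is `0` or `-1`, i.e. that its digits are constant. It holds at
  -- `m` and passes along every edge that is not `unfinished`.
  have key : ∀ u : S, (height d u - height d m) / 2 ^ i +
      (height d u - height d m) / 2 ^ i % 2 = 0 := by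
    refine connected_induction hS _ m (by simp) ?_
    intro v w e he hv
    have hb' := hb v e (by simp [occupied, ← he])
    rw [MState.unfinished, digit_int, h.diff m hm, ← he] at hb'
    simp only [ne_eq, decide_not, Bool.not_eq_false', decide_eq_true_eq] at hb'
    omega
  have hu := key u
  unfold digit
  have : (height d u - height d m) / 2 ^ i = 0 ∨ (height d u - height d m) / 2 ^ i = -1 := by
    omega
  rcases this with h0 | h0 <;> simp [h0]

/-- For `i ≥ L` every shifted height is `0` or `-1`, and no edge can look unfinished. This bounds
the number of digits in a pass. -/
theorem Rep.lt_of_unfinished {s : S → MState} {i L : ℕ} {stage any : Bool}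
    (h : Rep d s i stage any)
    (hL : ∀ u v : S, height d u - height d v < 2 ^ L) {m u : S} {e : AxisDir}
    (hm : (s m).ref = true) (ho : occupied S u e = true)
    (hb : MState.unfinished (digit d i m u) ((s u).diff e) = true) : i < L := by
  by_contra hi
  have hpow : (2 : ℤ) ^ L ≤ 2 ^ i := pow_le_pow_right₀ (by norm_num) (by omega)
  have hP : (0 : ℤ) < 2 ^ i := by positivity
  have key : ∀ v : S, (height d v - height d m) / 2 ^ i = 0 ∨
      (height d v - height d m) / 2 ^ i = -1 := by
    intro v
    have h1 := hL v m
    have h2 := hL m v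
    have h3 : (height d v - height d m) / 2 ^ i < 1 := Int.ediv_lt_of_lt_mul hP (by linarith)
    have h4 : -1 ≤ (height d v - height d m) / 2 ^ i := Int.le_ediv_of_mul_le hP (by linarith)
    omega
  have ho' : (u : Node) + e.vec ∈ S := by simpa [occupied] using ho
  rw [MState.unfinished, digit_int, h.diff m hm] at hb
  have h1 := key u
  have h2 := key ⟨_, ho'⟩
  simp only [ne_eq, decide_not, Bool.not_eq_true', decide_eq_false_iff_not] at hb
  simp only at h2
  omega


/-! ### The possible outcomes of a cycle -/

theorem emod_eq_self_of_ediv {x P : ℤ} (h : x / P = 0) : x % P = x := by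
  have := Int.emod_add_mul_ediv x P
  rw [h] at this
  simpa using this

theorem PassInv.conflict_step {s s' : S → MState} {B i : ℕ} {stage any : Bool}
    (h : PassInv R d s B i stage any)
    (href : ∀ u, (s' u).ref = true → (s u).ref = true) (hex : ∃ u, (s' u).ref = true)
    (hs : ∀ u, ∃ k t b z r, s' u = { s u with
      phase := .reference, conflict := k, tails := t, bit := b, busy := z, ref := r }) :
    PassInv R d s' B i stage any := by
  choose k t b z r hs using hs
  have hcand : ∀ u, (s' u).cand = (s u).cand := fun u => by rw [hs]
  have hmark : ∀ u, (s' u).mark = (s u).mark := fun u => by rw [hs]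
  have hdiff : ∀ u, (s' u).diff = (s u).diff := fun u => by rw [hs]
  exact
    { dir := fun u => by rw [hs]; exact h.dir u
      phase := fun u => by rw [hs]
      stage_eq := fun u => by rw [hs]; exact h.stage_eq u
      any_eq := fun u => by rw [hs]; exact h.any_eq u
      ans := fun u => by rw [hs]; exact h.ans u
      exists_ref := hex
      agree := fun m m' hm hm' => h.agree m m' (href m hm) (href m' hm')
      diff := fun m hm u e => by rw [hdiff]; exact h.diff m (href m hm) u e
      cand_mem := fun u hu => h.cand_mem u (by rwa [← hcand])
      top := fun u hu hm => by rw [hcand]; exact h.top u hu hm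
      spread := fun q q' hq hq' => h.spread q q' (by rwa [← hcand]) (by rwa [← hcand])
      ref_cand := fun m hm => by rw [hcand]; exact h.ref_cand m (href m hm)
      ref_le := fun hst m q hm hq => h.ref_le hst m q (href m hm) (by rwa [← hcand])
      ref_eq := fun hst m m' hm hm' => h.ref_eq hst m m' (href m hm) (href m' hm')
      not_any := fun hst ha m q hm hq => h.not_any hst ha m q (href m hm) (by rwa [← hcand])
      mark := fun hst ha => by
        obtain ⟨b, ⟨q, hq⟩, hb⟩ := h.mark hst ha
        refine ⟨b, ⟨q, by rwa [hcand, hmark]⟩, fun m q hm hq => ?_⟩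
        rw [hmark]
        exact hb m q (href m hm) (by rwa [← hcand]) }

theorem PassInv.digit_step {s s' : S → MState} {B i : ℕ} {stage any : Bool}
    (h : PassInv R d s B i stage any)
    (href : ∀ u, (s' u).ref = true → (s u).ref = true) (hex : ∃ u, (s' u).ref = true)
    {bit : S → Bool} {ones : Bool}
    (hno : ∀ m m' : S, (s m).ref = true → (s m').ref = true → digit d i m m' = false)
    (hbit : ∀ m, (s m).ref = true → ∀ u : S, bit u = digit d i m u)
    (hones : ones = true ↔ stage = true ∧ ∃ v, (s v).cand = true ∧ bit v = true)
    (hs : ∀ u, ∃ k t z r, s' u = { s u with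
      phase := .reference, conflict := k, tails := t, bit := bit u, busy := z, ref := r,
      any := (s u).any || ones, mark := if ones then bit u else (s u).mark,
      diff := fun e => MState.halve (bit u) ((s u).diff e) }) :
    PassInv R d s' B (i + 1) stage (any || ones) := by
  choose k t z r hs using hs
  have hcand : ∀ u, (s' u).cand = (s u).cand := fun u => by rw [hs]
  have hmark : ∀ u, (s' u).mark = if ones then bit u else (s u).mark := fun u => by rw [hs]
  have hdiff : ∀ u e, (s' u).diff e = MState.halve (bit u) ((s u).diff e) := fun u e => by rw [hs]
  have hP : (0 : ℤ) < 2 ^ i := by positivity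
  have hint : ∀ m, (s m).ref = true → ∀ u : S, (if bit u then 1 else 0 : ℤ) =
      (height d u - height d m) / 2 ^ i % 2 := by
    intro m hm u
    rw [hbit m hm, digit_int]
  -- If no candidate has a one, the residues do not change and the old mark remains valid.
  have hzero : ones = false → stage = true → ∀ m q : S, (s m).ref = true → (s q).cand = true →
      (height d q - height d m) % 2 ^ (i + 1) = (height d q - height d m) % 2 ^ i := by
    intro ho hst m q hm hq
    have hb : bit q = false := by
      by_contra hb
      have := hones.2 ⟨hst, q, hq, by simpa using hb⟩
      simp [ho] at this
    have := hint m hm q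
    rw [emod_two_pow_succ, ← this, hb]
    simp
  exact
    { dir := fun u => by rw [hs]; exact h.dir u
      phase := fun u => by rw [hs]
      stage_eq := fun u => by rw [hs]; exact h.stage_eq u
      any_eq := fun u => by rw [hs]; simp [h.any_eq u]
      ans := fun u => by rw [hs]; exact h.ans u
      exists_ref := hex
      agree := fun m m' hm hm' => by
        obtain ⟨c, hc⟩ := h.agree m m' (href m hm) (href m' hm')
        have h1 := hno m' m (href m' hm') (href m hm)
        have h2 := digit_int (d := d) i m' m
        rw [h1, hc, Int.mul_ediv_cancel_left _ hP.ne'] at h2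
        -- Agreement modulo `2 ^ i` and in digit `i` is agreement modulo `2 ^ (i + 1)`.
        obtain ⟨c', rfl⟩ : (2 : ℤ) ∣ c := Int.dvd_of_emod_eq_zero (by simpa using h2.symm)
        exact ⟨c', by rw [hc, pow_succ]; ring⟩
      diff := fun m hm u e => by
        rw [hdiff]
        simp only [MState.halve]
        rw [hint m (href m hm), h.diff m (href m hm), ediv_two_pow_succ, ediv_two_pow_succ]
        omega
      cand_mem := fun u hu => h.cand_mem u (by rwa [← hcand])
      top := fun u hu hm => by rw [hcand]; exact h.top u hu hm
      spread := fun q q' hq hq' => h.spread q q' (by rwa [← hcand]) (by rwa [← hcand])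
      ref_cand := fun m hm => by rw [hcand]; exact h.ref_cand m (href m hm)
      ref_le := fun hst m q hm hq => h.ref_le hst m q (href m hm) (by rwa [← hcand])
      ref_eq := fun hst m m' hm hm' => h.ref_eq hst m m' (href m hm) (href m' hm')
      not_any := fun hst ha m q hm hq => by
        simp only [Bool.or_eq_false_iff] at ha
        rw [hcand] at hq
        rw [hzero ha.2 hst m q (href m hm) hq]
        exact h.not_any hst ha.1 m q (href m hm) hq
      mark := fun hst ha => by
        cases ho : ones
        · rw [ho, Bool.or_false] at ha
          obtain ⟨b, ⟨q, hq⟩, hb⟩ := h.mark hst ha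
          refine ⟨b, ⟨q, by simpa [hcand, hmark, ho] using hq⟩, fun m q hm hq => ?_⟩
          rw [hcand] at hq
          rw [hmark, ho, hzero ho hst m q (href m hm) hq]
          exact hb m q (href m hm) hq
        · obtain ⟨-, q, hq⟩ := hones.1 ho
          -- The new digit outweighs all earlier ones, so the marked position moves to `i`.
          refine ⟨i, ⟨q, by simpa [hcand, hmark, ho] using hq⟩, fun m q hm hq => ?_⟩
          have h1 := hint m (href m hm) q
          have h2 := Int.emod_nonneg (height d q - height d m) hP.ne'
          have h3 := Int.emod_lt_of_pos (height d q - height d m) hP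
          have h4 : (2 : ℤ) ^ (i + 1) = 2 ^ i * 2 := pow_succ _ _
          rw [hmark, ho, emod_two_pow_succ, ← h1]
          constructor <;> intro hb <;> simp only [if_true] at hb <;> rw [hb]
          · simp only [if_true, mul_one]
            constructor <;> linarith
          · simp only [Bool.false_eq_true, if_false, mul_zero]
            linarith }

/-- The final digit is a sign. A maximum of `R` survives because the references lie in `R` and so
cannot be above it. -/
theorem PassInv.sign_step {s s' : S → MState} {B i : ℕ} {any : Bool}
    (h : PassInv R d s B i false any)
    (href : ∀ u, (s' u).ref = true → (s u).ref = true) (hex : ∃ u, (s' u).ref = true)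
    (heq : ∀ m m' : S, (s m).ref = true → (s m').ref = true → height d m = height d m')
    {bit : S → Bool}
    (hbit : ∀ m, (s m).ref = true → ∀ u : S,
      bit u = false ↔ height d m ≤ height d u)
    (hs : ∀ u, ∃ k t z r, s' u = { s u with
      phase := .reference, conflict := k, tails := t, bit := bit u, busy := z, ref := r,
      stage := true, any := false, cand := (s u).cand && !bit u, diff := slope (s u).dir }) :
    PassInv R d s' B 0 true false := by
  choose k t z r hs using hs
  have hcand : ∀ u, (s' u).cand = true ↔ (s u).cand = true ∧ bit u = false :=
    fun u => by rw [hs]; simp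
  exact
    { dir := fun u => by rw [hs]; exact h.dir u
      phase := fun u => by rw [hs]
      stage_eq := fun u => by rw [hs]
      any_eq := fun u => by rw [hs]
      ans := fun u => by rw [hs]; exact h.ans u
      exists_ref := hex
      agree := fun m m' hm hm' => by simp
      diff := fun m hm u e => by
        rw [hs]
        simp [slope, h.dir, height_add]
      cand_mem := fun u hu => h.cand_mem u ((hcand u).1 hu).1
      top := fun u hu hm => (hcand u).2 ⟨h.top u hu hm, by
        obtain ⟨m, hm'⟩ := h.exists_ref
        exact (hbit m hm' u).2 (hm m (h.cand_mem m (h.ref_cand m hm')))⟩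
      spread := fun q q' hq hq' => h.spread q q' ((hcand q).1 hq).1 ((hcand q').1 hq').1
      ref_cand := fun m hm =>
        (hcand m).2 ⟨h.ref_cand m (href m hm), (hbit m (href m hm) m).2 le_rfl⟩
      ref_le := fun _ m q hm hq => (hbit m (href m hm) q).1 ((hcand q).1 hq).2
      ref_eq := fun _ m m' hm hm' => heq m m' (href m hm) (href m' hm')
      not_any := fun _ _ m q _ _ => by simp
      mark := fun _ ha => by simp at ha }

/-- At the end of the pass the residues are the full heights above the references. The marked
candidates lie in `[2 ^ b, 2 ^ (b + 1))`, an interval of length `2 ^ b`, and all others are lower.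
-/
theorem PassInv.mark_step {s s' : S → MState} {B i : ℕ}
    (h : PassInv R d s B i true true)
    (hdiv : ∀ m q : S, (s m).ref = true → (s q).cand = true →
      (height d q - height d m) / 2 ^ i = 0)
    (hs : ∀ u, ∃ k t z b, s' u = { s u with
      phase := .reference, conflict := k, tails := t, bit := b, busy := z,
      ref := (s u).cand && (s u).mark,
      stage := false, any := false, cand := (s u).cand && (s u).mark, diff := slope (s u).dir }) :
    ∃ B', B = B' + 1 ∧ PassInv R d s' B' 0 false false := by
  choose k t z bit hs using hs
  have hcand : ∀ u, (s' u).cand = true ↔ (s u).cand = true ∧ (s u).mark = true :=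
    fun u => by rw [hs]; simp
  have href : ∀ u, (s' u).ref = true ↔ (s u).cand = true ∧ (s u).mark = true :=
    fun u => by rw [hs]; simp
  obtain ⟨b, ⟨q₀, hq₀, hm₀⟩, hb⟩ := h.mark rfl rfl
  obtain ⟨m, hm⟩ := h.exists_ref
  have hb' := fun q hq => hb m q hm hq
  have hb : ∀ q, (s q).cand = true →
      ((s q).mark = true → 2 ^ b ≤ height d q - height d m ∧
        height d q - height d m < 2 ^ (b + 1)) ∧
      ((s q).mark = false → height d q - height d m < 2 ^ b) := by
    intro q hq
    have := hb' q hq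
    rwa [emod_eq_self_of_ediv (hdiv m q hm hq)] at this
  have h4 : (2 : ℤ) ^ (b + 1) = 2 ^ b * 2 := pow_succ _ _
  -- The reference `m` is itself a candidate, and `q₀` is at least `2 ^ b` above it.
  have hlt : b < B := by
    have h1 := ((hb q₀ hq₀).1 hm₀).1
    have h2 := h.spread q₀ m hq₀ (h.ref_cand m hm)
    exact (pow_lt_pow_iff_right₀ (by norm_num : (1 : ℤ) < 2)).1 (h1.trans_lt h2)
  obtain ⟨B', rfl⟩ : ∃ B', B = B' + 1 := ⟨B - 1, by omega⟩
  have hpow : (2 : ℤ) ^ b ≤ 2 ^ B' := pow_le_pow_right₀ (by norm_num) (by omega)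
  refine ⟨B', rfl, ?_⟩
  exact
    { dir := fun u => by rw [hs]; exact h.dir u
      phase := fun u => by rw [hs]
      stage_eq := fun u => by rw [hs]
      any_eq := fun u => by rw [hs]
      ans := fun u => by rw [hs]; exact h.ans u
      exists_ref := ⟨q₀, (href q₀).2 ⟨hq₀, hm₀⟩⟩
      agree := fun m m' hm hm' => by simp
      diff := fun m hm u e => by
        rw [hs]
        simp [slope, h.dir, height_add]
      cand_mem := fun u hu => h.cand_mem u ((hcand u).1 hu).1
      top := fun u hu htop => (hcand u).2 ⟨h.top u hu htop, by
        by_contra hmark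
        have h1 := ((hb q₀ hq₀).1 hm₀).1
        have h2 := (hb u (h.top u hu htop)).2 (by simpa using hmark)
        have h3 := htop q₀ (h.cand_mem q₀ hq₀)
        linarith⟩
      spread := fun q q' hq hq' => by
        obtain ⟨hq, hqm⟩ := (hcand q).1 hq
        obtain ⟨hq', hqm'⟩ := (hcand q').1 hq'
        have h1 := (hb q hq).1 hqm
        have h2 := (hb q' hq').1 hqm'
        linarith
      ref_cand := fun m hm => (hcand m).2 ((href m).1 hm)
      ref_le := fun hst => by simp at hst
      ref_eq := fun hst => by simp at hst
      not_any := fun hst => by simp at hst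
      mark := fun hst => by simp at hst }

theorem PassInv.cand_iff_mem_globalMaxima {s : S → MState} {B i : ℕ}
    (h : PassInv R d s B i true false) (hRS : R ⊆ S)
    (hdiv : ∀ m q : S, (s m).ref = true → (s q).cand = true →
      (height d q - height d m) / 2 ^ i = 0) (u : S) :
    (s u).cand = decide ((u : Node) ∈ globalMaxima d R) := by
  rw [Bool.eq_iff_iff, decide_eq_true_iff, mem_globalMaxima_iff]
  refine ⟨fun hu => ⟨h.cand_mem u hu, fun v hv => ?_⟩, fun hu => h.top u hu.1 hu.2⟩
  obtain ⟨m, hm⟩ := h.exists_ref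
  have heq : ∀ q : S, (s q).cand = true → height d q = height d m := by
    intro q hq
    have h1 := h.not_any rfl rfl m q hm hq
    rw [emod_eq_self_of_ediv (hdiv m q hm hq)] at h1
    linarith
  obtain ⟨w, hw, hmax⟩ := R.exists_max_image (height d) ⟨v, hv⟩
  have h1 := hmax v hv
  have h2 := heq ⟨w, hRS hw⟩ (h.top ⟨w, hRS hw⟩ hw hmax)
  have h3 := heq u hu
  simp only at h2
  linarith

/-- The effect of one cycle. -/
theorem PassInv.step (hS : (triGrid.induce (S : Set Node)).Connected) (hn : 2 ≤ S.card)
    (hRS : R ⊆ S) (ω : ℕ × S → Bool) {t B i L : ℕ} {stage any : Bool}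
    (hL : ∀ u v : S, height d u - height d v < 2 ^ L)
    (h : PassInv R d (states S R d ω t) B i stage any) :
    (∃ i' any', PassInv R d (states S R d ω (t + 3)) B i' stage any' ∧
      Continue (states S R d ω t) (states S R d ω (t + 3)) (fun u => ω (t, u)) ∧
      ((i' = i ∧ ∃ u v, u ≠ v ∧ (states S R d ω t u).ref = true ∧
        (states S R d ω t v).ref = true) ∨ (i' = i + 1 ∧ i < L))) ∨
    (stage = false ∧ PassInv R d (states S R d ω (t + 3)) B 0 true false) ∨
    (stage = true ∧ ∃ B', B = B' + 1 ∧
      PassInv R d (states S R d ω (t + 3)) B' 0 false false) ∨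
    (∀ u, (states S R d ω (t + 3) u).ans = some (decide ((u : Node) ∈ globalMaxima d R))) := by
  obtain ⟨conflict, heads, busy, ones, bit, hc, hh, hb, ho, hbit, hs⟩ := cycle hS hn ω h.toRep
  choose z hs using hs
  obtain ⟨hex, hcoin⟩ := elimination hh h.exists_ref
  generalize states S R d ω (t + 3) = s' at hs ⊢
  generalize states S R d ω t = s at *
  cases conflict
  · have hno : ∀ m m' : S, (s m).ref = true → (s m').ref = true → digit d i m m' = false := by
      intro m m' hm hm'
      by_contra hd
      exact absurd (hc.2 ⟨m, m', hm, hm', by simpa using hd⟩) (by simp)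
    have hbit := hbit rfl
    cases busy
    · right
      obtain ⟨m₀, hm₀⟩ := h.exists_ref
      have hfin : ∀ m, (s m).ref = true → ∀ u : S,
          (height d u - height d m) / 2 ^ i = 0 ∧ bit u = false ∨
          (height d u - height d m) / 2 ^ i = -1 ∧ bit u = true := by
        intro m hm u
        rw [hbit m hm u]
        refine h.toRep.finished hS hm (fun v e he => ?_) u
        by_contra hu
        refine absurd (hb.2 ⟨v, e, he, ?_⟩) (by simp)
        rw [hbit m hm v]
        simpa using hu
      have hP : (0 : ℤ) < 2 ^ i := by positivity
      -- A quotient of `0` or `-1` is exactly the sign of the height difference.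
      have hle : ∀ m, (s m).ref = true → ∀ u : S, bit u = false ↔ height d m ≤ height d u := by
        intro m hm u
        have h1 := Int.emod_add_mul_ediv (height d u - height d m) (2 ^ i)
        have h2 := Int.emod_nonneg (height d u - height d m) hP.ne'
        have h3 := Int.emod_lt_of_pos (height d u - height d m) hP
        rcases hfin m hm u with ⟨h4, h5⟩ | ⟨h4, h5⟩ <;> rw [h4] at h1 <;> simp [h5] <;> linarith
      have heq : ∀ m m' : S, (s m).ref = true → (s m').ref = true →
          height d m = height d m' := by
        intro m m' hm hm'
        apply le_antisymm
        · rw [← hle m hm m', hbit m hm, hno m m' hm hm']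
        · rw [← hle m' hm' m, hbit m' hm', hno m' m hm' hm]
      cases stage
      · left
        refine ⟨rfl, h.sign_step (bit := bit) ?_ ?_ heq hle fun u => ?_⟩
        · intro u hu
          rw [hs] at hu
          simp [MState.afterReport, h.stage_eq] at hu
          exact hu.1
        · obtain ⟨m, hm⟩ := hex
          exact ⟨m, by rw [hs]; simpa [MState.afterReport, h.stage_eq] using hm⟩
        · rw [hs]
          exact ⟨false, !ω (t, u), z u, (s u).ref && !(!ω (t, u) && heads),
            by simp [MState.afterReport, h.stage_eq]⟩
      · right
        have hdiv : ∀ m q : S, (s m).ref = true → (s q).cand = true →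
            (height d q - height d m) / 2 ^ i = 0 := by
          intro m q hm hq
          have h1 := (hle m hm q).2 (h.ref_le rfl m q hm hq)
          rcases hfin m hm q with h2 | h2
          · exact h2.1
          · simp [h1] at h2
        cases any
        · right
          intro u
          rw [hs, ← h.cand_iff_mem_globalMaxima hRS hdiv u]
          simp [MState.afterReport, h.stage_eq, h.any_eq]
        · left
          refine ⟨rfl, h.mark_step hdiv fun u => ?_⟩
          rw [hs]
          exact ⟨false, !ω (t, u), z u, bit u,
            by simp [MState.afterReport, h.stage_eq, h.any_eq]⟩
    · left
      have href : ∀ u, (s' u).ref = ((s u).ref && !(!ω (t, u) && heads)) := by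
        intro u
        rw [hs]
        simp [MState.afterReport]
      have hsub : ∀ u, (s' u).ref = true → (s u).ref = true := by
        intro u hu
        rw [href, Bool.and_eq_true] at hu
        exact hu.1
      refine ⟨i + 1, any || ones, h.digit_step (bit := bit) (ones := ones) hsub
        (by simpa [href] using hex) hno hbit ho fun u => ?_, ⟨hsub, fun u v => ?_⟩,
        Or.inr ⟨rfl, ?_⟩⟩
      · rw [hs]
        exact ⟨false, !ω (t, u), z u, (s u).ref && !(!ω (t, u) && heads),
          by simp [MState.afterReport]⟩
      · rw [href, href]
        exact hcoin u v
      · obtain ⟨u, e, he, hu⟩ := hb.1 rfl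
        obtain ⟨m, hm⟩ := h.exists_ref
        rw [hbit m hm] at hu
        exact h.toRep.lt_of_unfinished hL hm he hu
  · left
    have href : ∀ u, (s' u).ref = ((s u).ref && !(!ω (t, u) && heads)) := by
      intro u
      rw [hs]
      simp [MState.afterReport]
    have hsub : ∀ u, (s' u).ref = true → (s u).ref = true := by
      intro u hu
      rw [href, Bool.and_eq_true] at hu
      exact hu.1
    obtain ⟨m, m', hm, hm', hd⟩ := hc.1 rfl
    refine ⟨i, any, h.conflict_step hsub (by simpa [href] using hex) fun u => ?_,
      ⟨hsub, fun u v => ?_⟩, Or.inl ⟨rfl, m, m', ?_, hm, hm'⟩⟩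
    · rw [hs]
      exact ⟨true, !ω (t, u), bit u, z u, (s u).ref && !(!ω (t, u) && heads),
        by simp [MState.afterReport]⟩
    · rw [href, href]
      exact hcoin u v
    · rintro rfl
      simp [digit_self] at hd


/-! ## The number of cycles -/

/-- A path has fewer than `n` edges, and each changes the height by at most 3. -/
theorem height_sub_le (hS : (triGrid.induce (S : Set Node)).Connected) (u v : S) :
    height d u - height d v ≤ 3 * S.card := by
  have key : ∀ (a b : (S : Set Node)) (p : (triGrid.induce (S : Set Node)).Walk a b),
      height d a - height d b ≤ 3 * p.length := by
    intro a b p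
    induction p with
    | nil => simp
    | cons hadj p ih =>
      have hadj' := hadj
      obtain ⟨e, he⟩ := hadj'
      have h1 := (slope d e).2.1
      simp only [slope] at h1
      have h2 := height_add d
      simp only [Function.Embedding.subtype_apply] at he
      rw [he, h2] at ih
      rw [SimpleGraph.Walk.length_cons]
      push_cast
      linarith
  obtain ⟨p, hp⟩ := hS.exists_isPath u v
  have h1 := hp.length_lt
  have h2 := key _ _ p
  simp only [SetLike.coe_sort_coe, Fintype.card_coe] at h1
  have h3 : (p.length : ℤ) < S.card := by exact_mod_cast h1
  linarith

/-- The two idle rounds are the source of the offset: cycle `j` begins at time `3 * j + 2`. -/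
theorem passInv_two (hS : (triGrid.induce (S : Set Node)).Connected) (hn : 2 ≤ S.card)
    (hRS : R ⊆ S) (hR : R.Nonempty) (ω : ℕ × S → Bool) {L : ℕ}
    (hL : ∀ u v : S, height d u - height d v < 2 ^ L) :
    PassInv R d (states S R d ω 2) L 0 false false := by
  have h0 : ∀ u, states S R d ω 0 u = MState.start d (decide ((u : Node) ∈ R)) := fun u => rfl
  obtain ⟨heads, hh, h1⟩ := coin_round (t := 0) (R := R) (d := d) hS hn ω
    (by intro u; rw [h0]; rfl) (by intro u; rw [h0]; rfl)
  obtain rfl : heads = false := by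
    by_contra hc
    obtain ⟨v, -, hv⟩ := hh.1 (by simpa using hc)
    rw [h0] at hv
    simp [MState.start] at hv
  obtain ⟨busy, ones, -, -, h2⟩ := report_round (t := 0 + 1) (R := R) (d := d) hS hn ω
    (by intro u; rw [h1]; rfl) (by intro u; rw [h1, h0]; rfl)
  have hs : ∀ u, ∃ z, states S R d ω 2 u =
      { MState.start d (decide ((u : Node) ∈ R)) with phase := .reference, busy := z } := by
    intro u
    refine ⟨(states S R d ω (0 + 1) u).busy, ?_⟩
    rw [show 2 = 0 + 1 + 1 from rfl, h2, h1, h0]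
    simp [MState.afterReport, MState.afterCoin, MState.start]
  choose z hs using hs
  have hcand : ∀ u, (states S R d ω 2 u).cand = true ↔ (u : Node) ∈ R := by
    intro u
    rw [hs]
    simp [MState.start]
  have href : ∀ u, (states S R d ω 2 u).ref = true ↔ (u : Node) ∈ R := by
    intro u
    rw [hs]
    simp [MState.start]
  obtain ⟨r, hr⟩ := hR
  exact
    { dir := fun u => by rw [hs]; rfl
      phase := fun u => by rw [hs]
      stage_eq := fun u => by rw [hs]; rfl
      any_eq := fun u => by rw [hs]; rfl
      ans := fun u => by rw [hs]; rfl
      exists_ref := ⟨⟨r, hRS hr⟩, (href _).2 hr⟩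
      agree := fun m m' hm hm' => by simp
      diff := fun m hm u e => by
        rw [hs]
        simp [slope, MState.start, height_add]
      cand_mem := fun u hu => (hcand u).1 hu
      top := fun u hu htop => (hcand u).2 hu
      spread := fun q q' _ _ => hL q q'
      ref_cand := fun m hm => (hcand m).2 ((href m).1 hm)
      ref_le := fun hst => by simp at hst
      ref_eq := fun hst => by simp at hst
      not_any := fun hst => by simp at hst
      mark := fun hst => by simp at hst }

/-- Every two amoebots toss different coins in one of the `k` cycles from cycle `j` on. -/
def Distinguished (ω : ℕ × S → Bool) (k j : ℕ) : Prop :=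
  ∀ u v : S, u ≠ v → ∃ a < k, ω (3 * (j + a) + 2, u) ≠ ω (3 * (j + a) + 2, v)

/-- The correct output. -/
def Solved (R : Finset Node) (d : Direction) (s : S → MState) : Prop :=
  ∀ u, (s u).ans = some (decide ((u : Node) ∈ globalMaxima d R))

/-- Surviving references have tossed equal coins throughout the pass. From its `k`-th cycle on there
is thus only one, and every cycle advances a digit, which can happen at most `L` times. -/
theorem PassInv.exists_end (hS : (triGrid.induce (S : Set Node)).Connected) (hn : 2 ≤ S.card)
    (hRS : R ⊆ S) (ω : ℕ × S → Bool) {j k B L : ℕ} {stage any : Bool}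
    (hL : ∀ u v : S, height d u - height d v < 2 ^ L)
    (h : PassInv R d (states S R d ω (3 * j + 2)) B 0 stage any) (hk : Distinguished ω k j) :
    ∃ j' ≤ j + (k + L + 1),
      (stage = false ∧ PassInv R d (states S R d ω (3 * j' + 2)) B 0 true false) ∨
      (stage = true ∧ ∃ B', B = B' + 1 ∧
        PassInv R d (states S R d ω (3 * j' + 2)) B' 0 false false) ∨
      Solved R d (states S R d ω (3 * j' + 2)) := by
  by_contra! hno
  -- The subtraction in `n - k ≤ i` is truncated: a conflict forces `n < k`, where the bound is
  -- vacuous.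
  have key : ∀ n ≤ k + L + 1, ∃ i any',
      PassInv R d (states S R d ω (3 * (j + n) + 2)) B i stage any' ∧ i ≤ L ∧ n - k ≤ i ∧ ∀ u v, (states S R d ω (3 * (j + n) + 2) u).ref = true →
        (states S R d ω (3 * (j + n) + 2) v).ref = true →
        ∀ a < n, ω (3 * (j + a) + 2, u) = ω (3 * (j + a) + 2, v) := by
    intro n
    induction n with
    | zero => exact fun _ => ⟨0, any, h, by simp, by simp, fun u v _ _ a ha => by omega⟩
    | succ n ih =>
      intro hnk
      obtain ⟨i, any', hi, hiL, hni, hc⟩ := ih (by omega)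
      have hno := hno (j + (n + 1)) (by omega)
      rw [show 3 * (j + (n + 1)) + 2 = 3 * (j + n) + 2 + 3 by ring] at hno ⊢
      rcases hi.step hS hn hRS ω hL with
        ⟨i', any'', hi', hcont, hcase⟩ | hend | ⟨hst, B', hB, hend⟩ | hend
      · refine ⟨i', any'', hi', ?_, ?_, ?_⟩
        · omega
        · rcases hcase with ⟨rfl, u, v, huv, hu, hv⟩ | ⟨rfl, -⟩
          · obtain ⟨a, ha, hne⟩ := hk u v huv
            have : ¬ a < n := fun han => hne (hc u v hu hv a han)
            omega
          · omega
        · intro u v hu hv a ha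
          rcases Nat.lt_succ_iff_lt_or_eq.1 ha with ha | rfl
          · exact hc u v (hcont.ref_sub u hu) (hcont.ref_sub v hv) a ha
          · exact hcont.ref_coin u v hu hv
      · exact absurd hend.2 (hno.1 hend.1)
      · exact absurd hend (hno.2.1 hst B' hB)
      · exact absurd hend hno.2.2
  obtain ⟨i, -, -, h1, h2, -⟩ := key (k + L + 1) le_rfl
  omega

/-- Two passes lower `B` by one. At `B = 0` the second pass cannot lower it further, so it must end
with the answer. -/
theorem PassInv.exists_solved (hS : (triGrid.induce (S : Set Node)).Connected) (hn : 2 ≤ S.card)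
    (hRS : R ⊆ S) (ω : ℕ × S → Bool) {k L K : ℕ}
    (hL : ∀ u v : S, height d u - height d v < 2 ^ L) (hk : ∀ j < K, Distinguished ω k j)
    (B : ℕ) : ∀ {j : ℕ}, PassInv R d (states S R d ω (3 * j + 2)) B 0 false false →
      j + 2 * (B + 1) * (k + L + 1) ≤ K →
      ∃ j' ≤ K, Solved R d (states S R d ω (3 * j' + 2)) := by
  induction B with
  | zero =>
    intro j h hj
    obtain ⟨j₁, hj₁, h₁⟩ := h.exists_end hS hn hRS ω hL (hk j (by nlinarith))
    rcases h₁ with ⟨-, h₁⟩ | ⟨h₁, -⟩ | h₁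
    · obtain ⟨j₂, hj₂, h₂⟩ := h₁.exists_end hS hn hRS ω hL (hk j₁ (by nlinarith))
      rcases h₂ with ⟨h₂, -⟩ | ⟨-, B', h₂, -⟩ | h₂
      · simp at h₂
      · omega
      · exact ⟨j₂, by nlinarith, h₂⟩
    · simp at h₁
    · exact ⟨j₁, by nlinarith, h₁⟩
  | succ B ih =>
    intro j h hj
    have hexp : 2 * (B + 1 + 1) * (k + L + 1) = 2 * (B + 1) * (k + L + 1) + 2 * (k + L + 1) := by
      ring
    obtain ⟨j₁, hj₁, h₁⟩ := h.exists_end hS hn hRS ω hL (hk j (by omega))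
    rcases h₁ with ⟨-, h₁⟩ | ⟨h₁, -⟩ | h₁
    · obtain ⟨j₂, hj₂, h₂⟩ := h₁.exists_end hS hn hRS ω hL (hk j₁ (by omega))
      rcases h₂ with ⟨h₂, -⟩ | ⟨-, B', hB', h₂⟩ | h₂
      · simp at h₂
      · obtain rfl : B = B' := by omega
        exact ih h₂ (by omega)
      · exact ⟨j₂, by omega, h₂⟩
    · simp at h₁
    · exact ⟨j₁, by omega, h₁⟩

theorem ans_mono (ω : ℕ × S → Bool) {t t' : ℕ} (h : t ≤ t') {u : S} {b : Bool}
    (hb : (states S R d ω t u).ans = some b) : (states S R d ω t' u).ans = some b := by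
  induction t', h using Nat.le_induction with
  | base => exact hb
  | succ t' _ ih => exact MState.ans_next _ _ _ _ _ ih

theorem solvedAt_of_distinguished (hS : (triGrid.induce (S : Set Node)).Connected)
    (hn : 2 ≤ S.card) (hRS : R ⊆ S) (hR : R.Nonempty) (ω : ℕ × S → Bool) {k L T : ℕ}
    (hL : 3 * S.card < 2 ^ L)
    (hk : ∀ j < 2 * (L + 1) * (k + L + 1), Distinguished ω k j)
    (hT : 3 * (2 * (L + 1) * (k + L + 1)) + 2 ≤ T) :
    maximaAlgorithm.SolvedAt S R d ω T := by
  have hL' : ∀ u v : S, height d u - height d v < 2 ^ L := fun u v =>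
    (height_sub_le hS u v).trans_lt (by exact_mod_cast hL)
  obtain ⟨j, hj, hs⟩ := PassInv.exists_solved (j := 0) hS hn hRS ω hL' hk L
    (passInv_two hS hn hRS hR ω hL') (by omega)
  exact fun u => ans_mono ω (by omega) (hs u)

/-! ## The probability -/

/-- The event is covered by `2 ^ I.card` boxes, one for each set `A` of times at which both coins
show `true`. Each box fixes `2 * I.card` independent coins. -/
theorem coinLaw_equal_le {u v : S} (huv : u ≠ v) (I : Finset ℕ) :
    coinLaw S {ω | ∀ t ∈ I, ω (t, u) = ω (t, v)} ≤ (2 ^ I.card)⁻¹ := by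
  classical
  have hsub : {ω : ℕ × S → Bool | ∀ t ∈ I, ω (t, u) = ω (t, v)} ⊆
      ⋃ A ∈ I.powerset, Set.pi (I ×ˢ {u, v} : Finset (ℕ × S)) (fun p => {decide (p.1 ∈ A)}) := by
    intro ω hω
    simp only [Set.mem_iUnion]
    refine ⟨I.filter fun t => ω (t, u) = true, by simp, ?_⟩
    rintro ⟨t, w⟩ hp
    simp only [Finset.coe_product, Set.mem_prod, Finset.mem_coe, Finset.mem_insert,
      Finset.mem_singleton] at hp
    obtain ⟨ht, rfl | rfl⟩ := hp
    · simp [ht]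
    · simp [ht, hω t ht]
  refine (measure_mono hsub).trans ((measure_biUnion_finset_le _ _).trans ?_)
  have hbox : ∀ A : Finset ℕ, coinLaw S (Set.pi (I ×ˢ {u, v} : Finset (ℕ × S))
      (fun p => {decide (p.1 ∈ A)})) = (2⁻¹ : ENNReal) ^ (I.card * 2) := by
    intro A
    rw [coinLaw, Measure.infinitePi_pi _ (fun _ _ => MeasurableSet.singleton _)]
    simp only [PMF.toMeasure_apply_singleton _ _ (MeasurableSet.singleton _),
      PMF.uniformOfFintype_apply, Fintype.card_bool, Finset.prod_const, Finset.card_product,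
      Finset.card_pair huv]
    rfl
  simp only [hbox, Finset.sum_const, Finset.card_powerset, nsmul_eq_mul]
  rw [pow_mul', sq, mul_pow, ← ENNReal.inv_pow, Nat.cast_pow, Nat.cast_two, ← mul_assoc,
    ENNReal.mul_inv_cancel (by simp) (by simp), one_mul]

/-- Union bound over the `K` windows and the ordered pairs of distinct amoebots. -/
theorem coinLaw_not_distinguished_le (k K : ℕ) :
    coinLaw S {ω | ¬ ∀ j < K, Distinguished ω k j} ≤ K * S.card ^ 2 * (2 ^ k)⁻¹ := by
  classical
  have hsub : {ω : ℕ × S → Bool | ¬ ∀ j < K, Distinguished ω k j} ⊆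
      ⋃ p ∈ Finset.range K ×ˢ (Finset.univ : Finset S).offDiag,
        {ω : ℕ × S → Bool | ∀ t ∈ (Finset.range k).image fun a => 3 * (p.1 + a) + 2,
          ω (t, p.2.1) = ω (t, p.2.2)} := by
    intro ω hω
    simp only [Set.mem_ofPred_eq, Distinguished] at hω
    push Not at hω
    obtain ⟨j, hj, u, v, huv, h⟩ := hω
    simp only [Set.mem_iUnion]
    refine ⟨(j, u, v), by simp [hj, huv], ?_⟩
    simpa using h
  refine (measure_mono hsub).trans ((measure_biUnion_finset_le _ _).trans ?_)
  have hle : ∀ p ∈ Finset.range K ×ˢ (Finset.univ : Finset S).offDiag,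
      coinLaw S {ω : ℕ × S → Bool | ∀ t ∈ (Finset.range k).image fun a => 3 * (p.1 + a) + 2,
          ω (t, p.2.1) = ω (t, p.2.2)} ≤ (2 ^ k)⁻¹ := by
    intro p hp
    have hne : p.2.1 ≠ p.2.2 := by simpa using (Finset.mem_product.1 hp).2
    refine (coinLaw_equal_le hne _).trans_eq ?_
    rw [Finset.card_image_of_injective _ (fun a b h => by simpa using h), Finset.card_range]
  refine (Finset.sum_le_sum hle).trans ?_
  rw [Finset.sum_const, nsmul_eq_mul]
  gcongr
  rw [Finset.card_product, Finset.card_range, Finset.offDiag_card, Finset.card_univ,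
    Fintype.card_coe]
  have : K * (S.card * S.card - S.card) ≤ K * S.card ^ 2 := by
    rw [sq]
    exact Nat.mul_le_mul_left _ (Nat.sub_le _ _)
  exact_mod_cast this

instance : IsProbabilityMeasure (coinLaw S) := by
  unfold coinLaw
  infer_instance

theorem le_coinLaw_distinguished (k K : ℕ) :
    1 - K * (S.card : ℝ) ^ 2 / 2 ^ k ≤
      (coinLaw S).real {ω | ∀ j < K, Distinguished ω k j} := by
  have h1 := measureReal_union_le (μ := coinLaw S) {ω | ∀ j < K, Distinguished ω k j}
    {ω | ∀ j < K, Distinguished ω k j}ᶜ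
  rw [Set.union_compl_self, probReal_univ] at h1
  have h2 : (coinLaw S).real {ω | ∀ j < K, Distinguished ω k j}ᶜ ≤
      K * (S.card : ℝ) ^ 2 / 2 ^ k := by
    refine ENNReal.toReal_le_of_le_ofReal (by positivity)
      ((coinLaw_not_distinguished_le k K).trans_eq ?_)
    rw [ENNReal.ofReal_div_of_pos (by positivity), ENNReal.ofReal_mul (by positivity),
      ENNReal.ofReal_pow (by positivity), ENNReal.ofReal_pow (by positivity), div_eq_mul_inv]
    simp
  linarith

/-! ## Parameters -/

/-- The number of cycles after which the coins have distinguished all amoebots, for structures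
of fewer than `2 ^ l` amoebots and the exponent `c`. -/
def windowLength (c l : ℕ) : ℕ := (2 * c + 10) * l

/-- A bound for the number of cycles. -/
def cycleBound (c l : ℕ) : ℕ := 2 * (l + 2 + 1) * (windowLength c l + (l + 2) + 1)

theorem pow_mul_cycleBound_le {c l n : ℕ} (hl : 2 ≤ l) (hn : n < 2 ^ l) :
    n ^ c * (cycleBound c l * n ^ 2) ≤ 2 ^ windowLength c l := by
  have h1 : l + 3 ≤ 2 ^ (2 * l) := by
    have := Nat.lt_two_pow_self (n := l)
    rw [two_mul, pow_add]
    nlinarith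
  have h2 : windowLength c l + (l + 2) + 1 ≤ (2 * c + 11) * 2 ^ (2 * l) := by
    unfold windowLength
    nlinarith
  have h3 : 2 * c + 11 ≤ 2 ^ ((c + 3) * l) := by
    have h4 : c + 3 < 2 ^ (c + 3) := Nat.lt_two_pow_self
    have h5 : 2 ^ ((c + 3) * 2) ≤ 2 ^ ((c + 3) * l) :=
      Nat.pow_le_pow_right (by norm_num) (Nat.mul_le_mul_left _ hl)
    rw [pow_mul] at h5
    nlinarith
  calc n ^ c * (cycleBound c l * n ^ 2)
      ≤ (2 ^ l) ^ c * (2 ^ l * 2 ^ (2 * l) * (2 ^ ((c + 3) * l) * 2 ^ (2 * l)) * (2 ^ l) ^ 2) := by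
        unfold cycleBound
        have h6 : 2 ≤ 2 ^ l := hl.trans Nat.lt_two_pow_self.le
        gcongr
        exact h2.trans (Nat.mul_le_mul_right _ h3)
    -- The exponents of `2 ^ l` add up to `c + 1 + 2 + (c + 3) + 2 + 2 = 2 * c + 10`, the factor in
    -- `windowLength`.
    _ = 2 ^ windowLength c l := by
        unfold windowLength
        rw [← pow_mul, ← pow_mul, ← pow_add, ← pow_add, ← pow_add, ← pow_add, ← pow_add]
        congr 1
        ring

theorem cycleBound_le {c l : ℕ} (hl : 2 ≤ l) :
    3 * cycleBound c l + 2 ≤ (36 * c + 300) * l ^ 2 := by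
  unfold cycleBound windowLength
  nlinarith [Nat.zero_le c, Nat.mul_le_mul_left c hl, Nat.mul_le_mul_left (c * l) hl]

theorem log_card_bound {n : ℕ} (hn : 2 ≤ n) :
    ((Nat.log 2 n + 1 : ℕ) : ℝ) ≤ 4 * Real.log n := by
  have h1 : 1 ≤ Nat.log 2 n := Nat.log_pos (by norm_num) hn
  have h2 : ((2 ^ Nat.log 2 n : ℕ) : ℝ) ≤ n := by
    exact_mod_cast Nat.pow_log_le_self 2 (by omega)
  have h3 := Real.log_le_log (by positivity) h2
  push_cast at h3
  rw [Real.log_pow] at h3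
  have h4 := Real.log_two_gt_d9
  have h5 : (1 : ℝ) ≤ Nat.log 2 n := by exact_mod_cast h1
  push_cast
  nlinarith

end Amoebot

/-! ### Choice of the parameters and conclusion -/

open Amoebot in
theorem mainTheorem2 :
    ∃ A : Amoebot.Algorithm 2, ∀ c : ℕ, ∃ C : ℝ,
      ∀ (S R : Finset Amoebot.Node) (d : Amoebot.Direction),
        (Amoebot.triGrid.induce (S : Set Amoebot.Node)).Connected → R ⊆ S → R.Nonempty →
        ∀ T : ℕ, C * Real.log (S.card : ℝ) ^ 2 ≤ (T : ℝ) →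
          1 - 1 / (S.card : ℝ) ^ c ≤
            (Amoebot.coinLaw S).real {ω | A.SolvedAt S R d ω T} := by
  -- `36 * c + 300` comes from `cycleBound_le`, and `16` is the square of the factor in
  -- `log_card_bound`.
  refine ⟨maximaAlgorithm, fun c => ⟨16 * (36 * c + 300), fun S R d hS hRS hR T hT => ?_⟩⟩
  have hpos : 0 < S.card := Finset.card_pos.2 (hR.mono hRS)
  rcases (show S.card = 1 ∨ 2 ≤ S.card by omega) with hone | hn
  -- For one amoebot the claimed lower bound is `0`.
  · rw [hone]
    simp
  set l := Nat.log 2 S.card + 1 with hl_def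
  have hl : 2 ≤ l := by
    have : 1 ≤ Nat.log 2 S.card := Nat.log_pos (by norm_num) hn
    omega
  have hnl : S.card < 2 ^ l := Nat.lt_pow_succ_log_self (by norm_num) _
  have hT' : 3 * cycleBound c l + 2 ≤ T := by
    refine (cycleBound_le hl).trans ?_
    have h1 := log_card_bound hn
    have h2 : ((l : ℕ) : ℝ) ^ 2 ≤ (4 * Real.log S.card) ^ 2 :=
      pow_le_pow_left₀ (by positivity) h1 2
    have h3 : ((36 * c + 300 : ℕ) : ℝ) * (l : ℝ) ^ 2 ≤ T := by
      refine le_trans ?_ hT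
      push_cast
      calc (36 * (c : ℝ) + 300) * (l : ℝ) ^ 2 ≤ (36 * (c : ℝ) + 300) * (4 * Real.log S.card) ^ 2 :=
            by gcongr
        _ = _ := by ring
    exact_mod_cast h3
  calc 1 - 1 / (S.card : ℝ) ^ c
      ≤ 1 - (cycleBound c l : ℕ) * (S.card : ℝ) ^ 2 / 2 ^ windowLength c l := by
        have h1 : ((S.card ^ c * (cycleBound c l * S.card ^ 2) : ℕ) : ℝ) ≤
            ((2 ^ windowLength c l : ℕ) : ℝ) := by
          exact_mod_cast pow_mul_cycleBound_le hl hnl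
        push_cast at h1
        have h2 : (0 : ℝ) < (S.card : ℝ) ^ c := by positivity
        refine sub_le_sub_left ?_ 1
        rw [div_le_div_iff₀ (by positivity) h2]
        linarith
    _ ≤ (coinLaw S).real {ω | ∀ j < cycleBound c l, Distinguished ω (windowLength c l) j} :=
        le_coinLaw_distinguished _ _
    _ ≤ _ := by
        refine measureReal_mono fun ω hω => ?_
        -- Two more digits than `l` absorb the factor 3 of `height_sub_le`.
        refine solvedAt_of_distinguished (L := l + 2) hS hn hRS hR ω ?_ hω hT'
        rw [pow_add]
        omega
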